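/- For a positive integer \(n\) and \(a\in\mathbb R\) let \(Q_4(a)=a(a+2)(a+2-n)(a+4-n)\), so that \(\Delta^2|x|^{-a}=Q_4(a)|x|^{-a-4}\) on \(\mathbb R^n\setminus\{0\}\). For \(p>1\) a regular radial solution is a positive, radially symmetric \(C^4\) function \(\phi:\mathbb R^n\to\mathbb R\) with \(\Delta^2\phi=\phi^p\) on \(\mathbb R^n\). If \(n\ge 13\), the equation \(p\,Q_4\left(\frac4{p-1}\right)=Q_4\left(\frac{n-4}2\right)\) has a unique solution \(p=p_c\) in \(\left(\frac{n+4}{n-4},\infty\right)\). Assume that \(n\ge 13\) and \(p\ge p_c\); equivalently, assume that \(n>4\), \(p>\frac{n+4}{n-4}\) and \[ p\,Q_4\left(\frac4{p-1}\right)\le Q_4\left(\frac{n-4}2\right). \] Put \(m=\frac4{p-1}\) and \(\Phi(x)=Q_4(m)^{1/(p-1)}|x|^{-m}\) for \(x\ne0\). Then: (a) every regular radial solution \(\phi\) satisfies \(\phi(x)<\Phi(x)\) for all \(x\neq 0\); in particular the graphs of \(\phi\) and \(\Phi\) do not intersect; (b) the graphs of two distinct regular radial solutions never intersect; moreover, regular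 radial solutions are strictly increasing in their value at the origin: if \(\phi,\psi\) are regular radial solutions with \(\phi(0)<\psi(0)\), then \(\phi(x)<\psi(x)\) for all \(x\in\mathbb R^n\). -/

import Mathlib

open scoped Laplacian

/-- The quartic `Q₄(a) = |x|^(a+4) Δ² |x|^(-a) = a (a + 2) (a + 2 - n) (a + 4 - n)`. -/
def quarticQ (n : ℕ) (a : ℝ) : ℝ :=
  a * (a + 2) * (a + 2 - n) * (a + 4 - n)

/-- The Sobolev exponent `(n + 4) / (n - 4)`, used only for `n > 4`. -/
noncomputable def sobolevExponent (n : ℕ) : ℝ :=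
  ((n : ℝ) + 4) / ((n : ℝ) - 4)

/-- The stability condition `p Q₄(4 / (p - 1)) ≤ Q₄((n - 4) / 2)`. -/
def StabilityCondition (n : ℕ) (p : ℝ) : Prop :=
  p * quarticQ n (4 / (p - 1)) ≤ quarticQ n (((n : ℝ) - 4) / 2)

/-- `pc` is a solution, larger than `(n + 4) / (n - 4)`, of the equation
`pc Q₄(4 / (pc - 1)) = Q₄((n - 4) / 2)`. -/
def IsCriticalExponent (n : ℕ) (pc : ℝ) : Prop :=
  sobolevExponent n < pc ∧
    pc * quarticQ n (4 / (pc - 1)) = quarticQ n (((n : ℝ) - 4) / 2)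

/-- `φ` is a regular radial solution: a positive, radially symmetric `C⁴` function on `ℝⁿ`
with `Δ² φ = φ ^ p` everywhere. -/
structure IsRegularRadialSolution (n : ℕ) (p : ℝ) (φ : EuclideanSpace ℝ (Fin n) → ℝ) :
    Prop where
  contDiff : ContDiff ℝ 4 φ
  pos : ∀ x, 0 < φ x
  radial : ∀ x y, ‖x‖ = ‖y‖ → φ x = φ y
  equation : ∀ x, Δ (Δ φ) x = φ x ^ p

/-- The singular solution `Φ(x) = Q₄(m)^(1/(p-1)) |x|^(-m)`, `m = 4 / (p - 1)`; it is meaningful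
for `x ≠ 0`. -/
noncomputable def singularSolution (n : ℕ) (p : ℝ) (x : EuclideanSpace ℝ (Fin n)) : ℝ :=
  quarticQ n (4 / (p - 1)) ^ (1 / (p - 1)) * ‖x‖ ^ (-(4 / (p - 1)))

/-! In the variable `s = log |x|` the radial bilaplacian is `e^(-4s) ∂ (∂ - 2) (∂ + n - 2) (∂ + n -
4)`. Conjugation by `e^(νs)`, `ν = (n - 4) / 2`, makes the constant-coefficient factor even: `(∂² -
ν²) (∂² - n²/4)`. Subtracting a constant `0 ≤ C ≤ ν² n²/4`, the Rellich constant, leaves a product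
`(∂² - τ₁²) (∂² - τ₂²)` with real `τ₁`, `τ₂`, and each factor obeys a minimum principle on
half-lines. This is `eq_zero_of_biharmonic_le`.

Suppose `w` reaches `y` from below. Near the origin `y - w` is larger than at the contact, and it
tends to `0` at infinity, so it attains a nonpositive minimum. Subtracting that minimum costs
nothing, since the operator kills constants. By convexity of the power the result `z ≥ 0` satisfies
the comparison inequality as soon as `p e^(4s) y^(p-1) ≤ C`, so `z` vanishes before the minimum
point, which contradicts its behaviour near the origin (`IsLogRadialSolution.lt_of_eventually_lt`).

For `y = Φ` the bound reads `p Q₄(m) ≤ C`, which is the stability condition and gives (a). By (a)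
every regular solution inherits the bound, and the same argument gives (b). Decay of regular
solutions at infinity comes from monotonicity, which rests on a blow-up argument. -/

section

open Filter Topology Set Real

/-! ### Minimum principles and the fourth-order comparison -/

/-- One-sided minimum principle for `∂² - τ²` on a half-line extending to `-∞`. -/
theorem nonneg_of_deriv2_le {τ s₁ : ℝ} {F F1 F2 : ℝ → ℝ}
    (h1 : ∀ s, HasDerivAt F (F1 s) s) (h2 : ∀ s, HasDerivAt F1 (F2 s) s)
    (hle : ∀ s ≤ s₁, F2 s ≤ τ ^ 2 * F s)
    (hlim : Tendsto (fun s => exp (τ * s) * F s) atBot (𝓝 0)) (hs₁ : 0 ≤ F s₁) :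
    ∀ s ≤ s₁, 0 ≤ F s := by
  have hexp : ∀ c s : ℝ, HasDerivAt (fun s => exp (c * s)) (exp (c * s) * c) s := fun c s => by
    simpa using ((hasDerivAt_id s).const_mul c).exp
  -- This is the factorisation `∂² - τ² = (∂ - τ) (∂ + τ)`: the weighted first-order quantity is
  -- antitone, so once negative it stays negative up to `s₁`.
  have hδ : ∀ s, HasDerivAt (fun s => exp (-τ * s) * (F1 s + τ * F s))
      (exp (-τ * s) * (F2 s - τ ^ 2 * F s)) s := fun s => by
    refine ((hexp (-τ) s).mul ((h2 s).add ((h1 s).const_mul τ))).congr_deriv ?_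
    simp only [Pi.add_apply]
    ring
  have hf : ∀ s, HasDerivAt (fun s => exp (τ * s) * F s) (exp (τ * s) * (F1 s + τ * F s)) s :=
    fun s => by
      refine ((hexp τ s).mul (h1 s)).congr_deriv ?_
      ring
  have hanti : AntitoneOn (fun s => exp (-τ * s) * (F1 s + τ * F s)) (Iic s₁) := by
    refine antitoneOn_of_deriv_nonpos (convex_Iic _)
      (fun s _ => (hδ s).continuousAt.continuousWithinAt)
      (fun s _ => (hδ s).differentiableAt.differentiableWithinAt) fun s hs => ?_
    rw [(hδ s).deriv]
    rw [interior_Iic] at hs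
    exact mul_nonpos_of_nonneg_of_nonpos (exp_pos _).le (by linarith [hle s (le_of_lt hs)])
  intro s hs
  by_contra! hneg
  have hfs : exp (τ * s) * F s < 0 := mul_neg_of_pos_of_neg (exp_pos _) hneg
  -- Since `e^(τs) F` tends to `0` at `-∞` and is negative at `s`, its slope is negative at some `c
  -- < s`. From there it keeps decreasing up to `s₁`, where it should be nonnegative.
  obtain ⟨a, haf, has⟩ :=
    ((hlim.eventually (lt_mem_nhds hfs)).and (eventually_lt_atBot s)).exists
  obtain ⟨c, hc, hcs⟩ := exists_hasDerivAt_eq_slope _ _ has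
    (fun x _ => (hf x).continuousAt.continuousWithinAt) (fun x _ => hf x)
  have hc' : F1 c + τ * F c < 0 := by
    have : exp (τ * c) * (F1 c + τ * F c) < 0 := by
      rw [hcs]
      exact div_neg_of_neg_of_pos (by linarith) (by linarith)
    exact (pos_iff_neg_of_mul_neg this).1 (exp_pos _)
  have hanti2 : AntitoneOn (fun s => exp (τ * s) * F s) (Icc c s₁) := by
    refine antitoneOn_of_deriv_nonpos (convex_Icc _ _)
      (fun s _ => (hf s).continuousAt.continuousWithinAt)
      (fun s _ => (hf s).differentiableAt.differentiableWithinAt) fun x hx => ?_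
    rw [(hf x).deriv]
    rw [interior_Icc] at hx
    have h := hanti (show c ∈ Iic s₁ from (hx.1.trans hx.2).le) (show x ∈ Iic s₁ from hx.2.le)
      hx.1.le
    have h' : exp (-τ * x) * (F1 x + τ * F x) < 0 :=
      h.trans_lt (mul_neg_of_pos_of_neg (exp_pos _) hc')
    exact (mul_neg_of_pos_of_neg (exp_pos _) ((pos_iff_neg_of_mul_neg h').1 (exp_pos _))).le
  have := hanti2 (show s ∈ Icc c s₁ from ⟨hc.2.le, hs⟩)
    (show s₁ ∈ Icc c s₁ from ⟨hc.2.le.trans hs, le_rfl⟩) hs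
  have h0 : 0 ≤ exp (τ * s₁) * F s₁ := mul_nonneg (exp_pos _).le hs₁
  simp only at this
  linarith

/-- Second-order necessary condition at a global minimum. -/
theorem deriv2_nonneg_of_min {F F1 F2 : ℝ → ℝ} {s₁ : ℝ}
    (h1 : ∀ s, HasDerivAt F (F1 s) s) (h2 : ∀ s, HasDerivAt F1 (F2 s) s)
    (hmin : ∀ s, F s₁ ≤ F s) : 0 ≤ F2 s₁ := by
  have hd : deriv F = F1 := funext fun s => (h1 s).deriv
  have hloc : IsLocalMin F s₁ := Eventually.of_forall hmin
  by_contra! hneg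
  -- A negative second derivative would make the minimum also a local maximum, hence `F` locally
  -- constant.
  have hmax : IsLocalMax F s₁ := isLocalMax_of_deriv_deriv_neg
    (by rw [hd, (h2 s₁).deriv]; exact hneg) hloc.deriv_eq_zero (h1 s₁).continuousAt
  have hconst : F =ᶠ[𝓝 s₁] fun _ => F s₁ := by
    filter_upwards [hmax] with s hs using le_antisymm hs (hmin s)
  have hc1 : F1 =ᶠ[𝓝 s₁] fun _ => 0 := by
    rw [← hd]
    exact (hconst.deriv).trans (Eventually.of_forall fun s => by simp)
  have := hc1.deriv_eq
  rw [(h2 s₁).deriv] at this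
  simp at this
  linarith

/-- The biharmonic comparison: a nonnegative `z` with
`∂ (∂ - 2) (∂ + n - 2) (∂ + n - 4) z ≤ C z`, `C` at most the Rellich constant, that vanishes
at `s₁` vanishes identically before. -/
theorem eq_zero_of_biharmonic_le {n C s₁ : ℝ} (hn : 4 < n) (hC0 : 0 ≤ C)
    (hC : C ≤ n ^ 2 * (n - 4) ^ 2 / 16) {z z1 z2 z3 z4 : ℝ → ℝ}
    (h1 : ∀ s, HasDerivAt z (z1 s) s) (h2 : ∀ s, HasDerivAt z1 (z2 s) s)
    (h3 : ∀ s, HasDerivAt z2 (z3 s) s) (h4 : ∀ s, HasDerivAt z3 (z4 s) s)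
    (hL : ∀ s, z4 s + 2 * (n - 4) * z3 s + (n ^ 2 - 10 * n + 20) * z2 s
      - 2 * (n - 2) * (n - 4) * z1 s ≤ C * z s)
    (hz : ∀ s, 0 ≤ z s) (hs₁ : z s₁ = 0)
    (l0 : Tendsto (fun s => exp ((n - 4) / 2 * s) * z s) atBot (𝓝 0))
    (l1 : Tendsto (fun s => exp ((n - 4) / 2 * s) * z1 s) atBot (𝓝 0))
    (l2 : Tendsto (fun s => exp ((n - 4) / 2 * s) * z2 s) atBot (𝓝 0)) :
    ∀ s ≤ s₁, z s = 0 := by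
  set ν := (n - 4) / 2 with hν
  -- The squares are the roots of `T² - (ν² + n²/4) T + (ν² n²/4 - C)`. The roots are real because
  -- `C ≥ 0`, and the smaller one is nonnegative exactly because `C` does not exceed the Rellich
  -- constant.
  obtain ⟨τ₁, τ₂, hτ₁, hτ₂, hsum, hprod⟩ : ∃ τ₁ τ₂ : ℝ, 0 ≤ τ₁ ∧ 0 ≤ τ₂ ∧
      τ₁ ^ 2 + τ₂ ^ 2 = ν ^ 2 + n ^ 2 / 4 ∧ τ₁ ^ 2 * τ₂ ^ 2 = n ^ 2 * (n - 4) ^ 2 / 16 - C := by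
    set d := (ν ^ 2 - n ^ 2 / 4) ^ 2 + 4 * C with hd
    have hd0 : 0 ≤ d := by positivity
    have hsd := Real.sq_sqrt hd0
    have hsd0 := Real.sqrt_nonneg d
    have hle : √d ≤ ν ^ 2 + n ^ 2 / 4 := by
      refine Real.sqrt_le_iff.2 ⟨by positivity, ?_⟩
      rw [hd, hν]
      nlinarith
    refine ⟨√((ν ^ 2 + n ^ 2 / 4 - √d) / 2), √((ν ^ 2 + n ^ 2 / 4 + √d) / 2), sqrt_nonneg _,
      sqrt_nonneg _, ?_, ?_⟩
    · rw [Real.sq_sqrt (by linarith), Real.sq_sqrt (by positivity)]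
      ring
    · rw [Real.sq_sqrt (by linarith), Real.sq_sqrt (by positivity)]
      have : (ν ^ 2 + n ^ 2 / 4 - √d) / 2 * ((ν ^ 2 + n ^ 2 / 4 + √d) / 2)
        = ((ν ^ 2 + n ^ 2 / 4) ^ 2 - √d ^ 2) / 4 := by ring
      rw [this, hsd, hd, hν]
      ring
  have hexp : ∀ s : ℝ, HasDerivAt (fun s => exp (ν * s)) (exp (ν * s) * ν) s := fun s => by
    simpa using ((hasDerivAt_id s).const_mul ν).exp
  have hstep : ∀ {f f' : ℝ → ℝ}, (∀ s, HasDerivAt f (f' s) s) →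
      ∀ s, HasDerivAt (fun s => exp (ν * s) * f s) (exp (ν * s) * (f' s + ν * f s)) s :=
    fun {f f'} hf s => ((hexp s).mul (hf s)).congr_deriv (by ring)
  have d0 := hstep h1
  have d1 := hstep (f := fun s => z1 s + ν * z s) (f' := fun s => z2 s + ν * z1 s)
    fun s => (h2 s).add ((h1 s).const_mul ν)
  have d2 := hstep (f := fun s => z2 s + 2 * ν * z1 s + ν ^ 2 * z s)
    (f' := fun s => z3 s + 2 * ν * z2 s + ν ^ 2 * z1 s)
    fun s => ((h3 s).add ((h2 s).const_mul _)).add ((h1 s).const_mul _)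
  have d3 := hstep (f := fun s => z3 s + 3 * ν * z2 s + 3 * ν ^ 2 * z1 s + ν ^ 3 * z s)
    (f' := fun s => z4 s + 3 * ν * z3 s + 3 * ν ^ 2 * z2 s + ν ^ 3 * z1 s)
    fun s => (((h4 s).add ((h3 s).const_mul _)).add ((h2 s).const_mul _)).add
      ((h1 s).const_mul _)
  set Z := fun s => exp (ν * s) * z s with hZ
  set Z1 := fun s => exp (ν * s) * (z1 s + ν * z s) with hZ1
  set Z2 := fun s => exp (ν * s) * (z2 s + 2 * ν * z1 s + ν ^ 2 * z s) with hZ2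
  set Z3 := fun s => exp (ν * s) * (z3 s + 3 * ν * z2 s + 3 * ν ^ 2 * z1 s + ν ^ 3 * z s) with hZ3
  have e1 : ∀ s, HasDerivAt Z (Z1 s) s := d0
  have e2 : ∀ s, HasDerivAt Z1 (Z2 s) s := fun s => (d1 s).congr_deriv (by simp only [hZ2]; ring)
  have e3 : ∀ s, HasDerivAt Z2 (Z3 s) s := fun s => (d2 s).congr_deriv (by simp only [hZ3]; ring)
  have hZ0 : ∀ s, 0 ≤ Z s := fun s => mul_nonneg (exp_pos _).le (hz s)
  have hZs₁ : Z s₁ = 0 := by simp [hZ, hs₁]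
  have x1 : ∀ s, HasDerivAt (fun s => Z2 s - τ₂ ^ 2 * Z s) (Z3 s - τ₂ ^ 2 * Z1 s) s :=
    fun s => (e3 s).sub ((e1 s).const_mul _)
  have x2 := fun s => (d3 s).sub ((e2 s).const_mul (τ₂ ^ 2))
  have hlimX : Tendsto (fun s => Z2 s - τ₂ ^ 2 * Z s) atBot (𝓝 0) := by
    have := ((l2.add (l1.const_mul (2 * ν))).add (l0.const_mul (ν ^ 2))).sub
      (l0.const_mul (τ₂ ^ 2))
    simp only [mul_zero, add_zero, sub_zero] at this
    refine this.congr fun s => ?_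
    simp only [hZ2, hZ]
    ring
  have hbdd : ∀ τ : ℝ, 0 ≤ τ → ∀ f : ℝ → ℝ, Tendsto f atBot (𝓝 0) →
      Tendsto (fun s => exp (τ * s) * f s) atBot (𝓝 0) := fun τ hτ f hf => by
    refine squeeze_zero_norm' ?_ (tendsto_zero_iff_norm_tendsto_zero.1 hf)
    filter_upwards [eventually_le_atBot (0 : ℝ)] with s hs
    rw [norm_mul, Real.norm_eq_abs (exp _), abs_of_pos (exp_pos _)]
    refine mul_le_of_le_one_left (norm_nonneg _) (exp_le_one_iff.2 ?_)
    exact mul_nonpos_of_nonneg_of_nonpos hτ hs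
  -- At `s₁` the function `Z` has a global minimum with value `0`, so the quantity there is `Z''(s₁)
  -- ≥ 0`.
  have hX : ∀ s ≤ s₁, 0 ≤ Z2 s - τ₂ ^ 2 * Z s := by
    refine nonneg_of_deriv2_le (τ := τ₁) x1 x2 (fun s _ => ?_) (hbdd τ₁ hτ₁ _ hlimX) ?_
    · have key : exp (ν * s) * (z4 s + 3 * ν * z3 s + 3 * ν ^ 2 * z2 s + ν ^ 3 * z1 s
          + ν * (z3 s + 3 * ν * z2 s + 3 * ν ^ 2 * z1 s + ν ^ 3 * z s)) - τ₂ ^ 2 * Z2 s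
          - τ₁ ^ 2 * (Z2 s - τ₂ ^ 2 * Z s)
          = exp (ν * s) * (z4 s + 2 * (n - 4) * z3 s + (n ^ 2 - 10 * n + 20) * z2 s
            - 2 * (n - 2) * (n - 4) * z1 s - C * z s) := by
        have e : ∀ E Y Y2 : ℝ, E - τ₂ ^ 2 * Y2 - τ₁ ^ 2 * (Y2 - τ₂ ^ 2 * Y)
          = E - (τ₁ ^ 2 + τ₂ ^ 2) * Y2 + (τ₁ ^ 2 * τ₂ ^ 2) * Y := fun _ _ _ => by ring
        rw [e, hsum, hprod]
        simp only [hZ2, hZ, hν]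
        ring
      have : exp (ν * s) * (z4 s + 2 * (n - 4) * z3 s + (n ^ 2 - 10 * n + 20) * z2 s
            - 2 * (n - 2) * (n - 4) * z1 s - C * z s) ≤ 0 :=
        mul_nonpos_of_nonneg_of_nonpos (exp_pos _).le (by linarith [hL s])
      linarith
    · rw [hZs₁, mul_zero, sub_zero]
      exact deriv2_nonneg_of_min e1 e2 fun s => hZs₁ ▸ hZ0 s
  -- The second factor is applied to `-Z`, whose boundary value is also `0`; this pinches `Z`
  -- between `0` and `0`.
  have hZneg : ∀ s ≤ s₁, 0 ≤ -Z s := by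
    refine nonneg_of_deriv2_le (τ := τ₂) (F := fun s => -Z s) (fun s => (e1 s).neg) (fun s => (e2 s).neg)
      (fun s hs => by linarith [hX s hs]) ?_ (by rw [hZs₁, neg_zero])
    have := hbdd τ₂ hτ₂ _ l0
    simpa using this.neg
  intro s hs
  have : Z s = 0 := le_antisymm (by linarith [hZneg s hs]) (hZ0 s)
  exact (mul_eq_zero.1 this).resolve_left (exp_pos _).ne'

/-! ### Reduction to the logarithmic radial variable -/

/-- The Laplacian of a radial function, in the logarithmic radial variable. -/
theorem laplacian_eq_of_log_norm {n : ℕ} {F : EuclideanSpace ℝ (Fin n) → ℝ} {g g1 g2 : ℝ → ℝ}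
    (h1 : ∀ s, HasDerivAt g (g1 s) s) (h2 : ∀ s, HasDerivAt g1 (g2 s) s)
    {x : EuclideanSpace ℝ (Fin n)} (hx : x ≠ 0) (hF : ∀ y, y ≠ 0 → F y = g (log ‖y‖)) :
    Δ F x = exp (-2 * log ‖x‖) * (g2 (log ‖x‖) + (n - 2) * g1 (log ‖x‖)) := by
  have hnear : ∀ y : EuclideanSpace ℝ (Fin n), y ≠ 0 → ∀ᶠ w in 𝓝 y, w ≠ 0 := fun y hy =>
    isOpen_ne.mem_nhds hy
  have hsq : ∀ y : EuclideanSpace ℝ (Fin n), y ≠ 0 → HasFDerivAt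
      (fun y : EuclideanSpace ℝ (Fin n) => log ‖y‖) ((‖y‖ ^ 2)⁻¹ • innerSL ℝ y) y := fun y hy => by
    have hn2 : ‖y‖ ^ 2 ≠ 0 := pow_ne_zero _ (norm_ne_zero_iff.2 hy)
    have hd := ((hasStrictFDerivAt_norm_sq y).hasFDerivAt.log hn2).const_mul (1 / 2)
    -- Writing `log ‖y‖ = ½ log ‖y‖²` avoids differentiating the norm itself.
    have he : (fun y : EuclideanSpace ℝ (Fin n) => 1 / 2 * log (‖y‖ ^ 2)) =
        fun y => log ‖y‖ := by
      funext w
      rw [Real.log_pow]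
      push_cast
      ring
    rw [he] at hd
    refine hd.congr_fderiv ?_
    ext v
    simp
    ring
  have hfd : ∀ y : EuclideanSpace ℝ (Fin n), y ≠ 0 →
      HasFDerivAt F ((g1 (log ‖y‖) * (‖y‖ ^ 2)⁻¹) • innerSL ℝ y) y := fun y hy => by
    have := (h1 (log ‖y‖)).comp_hasFDerivAt y (hsq y hy)
    rw [smul_smul] at this
    exact this.congr_of_eventuallyEq ((hnear y hy).mono fun w hw => hF w hw)
  have hfd_eq : fderiv ℝ F =ᶠ[𝓝 x] fun y => (g1 (log ‖y‖) * (‖y‖ ^ 2)⁻¹) • innerSL ℝ y :=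
    (hnear x hx).mono fun y hy => (hfd y hy).fderiv
  have hx2 : ‖x‖ ^ 2 ≠ 0 := pow_ne_zero _ (norm_ne_zero_iff.2 hx)
  have hcoef := ((h2 (log ‖x‖)).comp_hasFDerivAt x (hsq x hx)).mul
    ((hasDerivAt_inv hx2).comp_hasFDerivAt x (hasStrictFDerivAt_norm_sq x).hasFDerivAt)
  have hsecond := (hcoef.smul ((innerSL ℝ (E := EuclideanSpace ℝ (Fin n))).hasFDerivAt (x := x)))
  have hsecond' := (hsecond.congr_of_eventuallyEq hfd_eq).fderiv
  rw [InnerProductSpace.laplacian_eq_iteratedFDeriv_orthonormalBasis F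
    (EuclideanSpace.basisFun (Fin n) ℝ)]
  have hterm : ∀ i : Fin n, iteratedFDeriv ℝ 2 F x ![EuclideanSpace.basisFun (Fin n) ℝ i,
      EuclideanSpace.basisFun (Fin n) ℝ i] =
      (g2 (log ‖x‖) - 2 * g1 (log ‖x‖)) * (‖x‖ ^ 2)⁻¹ ^ 2 * x i ^ 2
        + g1 (log ‖x‖) * (‖x‖ ^ 2)⁻¹ := fun i => by
    rw [iteratedFDeriv_two_apply, hsecond']
    have hi : innerSL ℝ x (EuclideanSpace.single i (1 : ℝ)) = x i := by
      rw [innerSL_apply_apply]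
      simp [EuclideanSpace.inner_single_right]
    have hii : innerSL ℝ (EuclideanSpace.single i (1 : ℝ)) (EuclideanSpace.single i (1 : ℝ)) =
        (1 : ℝ) := by
      rw [innerSL_apply_apply]
      simp
    simp only [EuclideanSpace.basisFun_apply, Matrix.cons_val_zero, Matrix.cons_val_one,
      add_apply, smul_apply, ContinuousLinearMap.smulRight_apply, Function.comp_apply,
      Pi.mul_apply, smul_eq_mul, nsmul_eq_mul, hi, hii]
    push_cast
    field_simp
    ring
  have hexp : exp (-2 * log ‖x‖) = (‖x‖ ^ 2)⁻¹ := by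
    rw [show -2 * log ‖x‖ = -(log (‖x‖ ^ 2)) by rw [Real.log_pow]; push_cast; ring, exp_neg,
      exp_log (by positivity)]
  have hnorm : ∑ i, x i ^ 2 = ‖x‖ ^ 2 := by
    rw [EuclideanSpace.norm_sq_eq]
    simp
  beta_reduce
  rw [Finset.sum_congr rfl fun i _ => hterm i, Finset.sum_add_distrib, ← Finset.mul_sum, hnorm,
    hexp]
  simp only [Finset.sum_const, Finset.card_univ, Fintype.card_fin, nsmul_eq_mul]
  field_simp
  ring

/-- A solution of the radial equation `Δ² φ = φ ^ p` on `ℝⁿ ∖ {0}`, in the variable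
`s = log |x|`, with its first three derivatives. -/
structure IsLogRadialSolution (n p : ℝ) (y y1 y2 y3 : ℝ → ℝ) : Prop where
  deriv0 : ∀ s, HasDerivAt y (y1 s) s
  deriv1 : ∀ s, HasDerivAt y1 (y2 s) s
  deriv2 : ∀ s, HasDerivAt y2 (y3 s) s
  deriv3 : ∀ s, HasDerivAt y3 (exp (4 * s) * y s ^ p - 2 * (n - 4) * y3 s
    - (n ^ 2 - 10 * n + 20) * y2 s + 2 * (n - 2) * (n - 4) * y1 s) s
  pos : ∀ s, 0 < y s

/-- Behaviour as `s = log |x| → -∞` of a solution that is regular at the origin. -/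
structure IsRegularAtBot (c : ℝ) (y y1 y2 y3 : ℝ → ℝ) : Prop where
  tendsto0 : Tendsto y atBot (𝓝 c)
  tendsto1 : Tendsto y1 atBot (𝓝 0)
  tendsto2 : Tendsto y2 atBot (𝓝 0)
  tendsto3 : Tendsto y3 atBot (𝓝 0)

/-- Along a ray, the `s`-derivatives are combinations of `r^j h^(j)(r)` with `r = e^s` and `j ≥ 1`,
so they vanish as `s → -∞`. The equation comes from applying `laplacian_eq_of_log_norm` twice. -/
theorem IsRegularRadialSolution.exists_logRadial {n : ℕ} (hn : 0 < n) {p : ℝ}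
    {φ : EuclideanSpace ℝ (Fin n) → ℝ} (hφ : IsRegularRadialSolution n p φ) :
    ∃ y y1 y2 y3 : ℝ → ℝ, (∀ x, x ≠ 0 → φ x = y (log ‖x‖)) ∧
      IsLogRadialSolution n p y y1 y2 y3 ∧ IsRegularAtBot (φ 0) y y1 y2 y3 := by
  set e : EuclideanSpace ℝ (Fin n) := EuclideanSpace.single ⟨0, hn⟩ 1 with he
  have hen : ‖e‖ = 1 := by simp [he]
  set h : ℝ → ℝ := fun r => φ (r • e) with hh
  have hC : ContDiff ℝ 4 h := hφ.contDiff.comp (contDiff_id.smul contDiff_const)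
  have hder : ∀ k : ℕ, k < 4 → ∀ r, HasDerivAt (iteratedDeriv k h) (iteratedDeriv (k + 1) h r) r :=
    fun k hk r => by
      rw [iteratedDeriv_succ]
      exact ((hC.differentiable_iteratedDeriv k (by exact_mod_cast hk)) r).hasDerivAt
  have hcont : ∀ k : ℕ, k ≤ 4 → Continuous (iteratedDeriv k h) := fun k hk =>
    hC.continuous_iteratedDeriv k (by exact_mod_cast hk)
  have hE : ∀ (j k : ℕ), k < 4 → ∀ s, HasDerivAt (fun s => exp s ^ j * iteratedDeriv k h (exp s))
      (j * exp s ^ j * iteratedDeriv k h (exp s)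
        + exp s ^ (j + 1) * iteratedDeriv (k + 1) h (exp s)) s := fun j k hk s => by
    refine (((Real.hasDerivAt_exp s).pow j).mul
      ((hder k hk (exp s)).comp s (Real.hasDerivAt_exp s))).congr_deriv ?_
    rcases j with _ | j
    · simp
      ring
    · simp [pow_succ]
      ring
  have e00 := hE 0 0 (by norm_num)
  have e11 := hE 1 1 (by norm_num)
  have e22 := hE 2 2 (by norm_num)
  have e33 := hE 3 3 (by norm_num)
  simp only [iteratedDeriv_zero, pow_zero, one_mul, zero_add, Nat.cast_zero, zero_mul,
    Nat.reduceAdd, Nat.cast_one, Nat.cast_ofNat] at e00 e11 e22 e33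
  set y := fun s => h (exp s) with hy
  set y1 := fun s => exp s ^ 1 * iteratedDeriv 1 h (exp s) with hy1
  set y2 := fun s => exp s ^ 1 * iteratedDeriv 1 h (exp s)
    + exp s ^ 2 * iteratedDeriv 2 h (exp s) with hy2
  set y3 := fun s => exp s ^ 1 * iteratedDeriv 1 h (exp s)
    + 3 * (exp s ^ 2 * iteratedDeriv 2 h (exp s))
    + exp s ^ 3 * iteratedDeriv 3 h (exp s) with hy3
  -- The coefficients `1, 7, 6, 1` are Stirling numbers of the second kind, from expanding `(r
  -- d/dr)^4`.
  set y4 := fun s => exp s ^ 1 * iteratedDeriv 1 h (exp s)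
    + 7 * (exp s ^ 2 * iteratedDeriv 2 h (exp s))
    + 6 * (exp s ^ 3 * iteratedDeriv 3 h (exp s))
    + exp s ^ 4 * iteratedDeriv 4 h (exp s) with hy4
  have d0 : ∀ s, HasDerivAt y (y1 s) s := e00
  have d1 : ∀ s, HasDerivAt y1 (y2 s) s := e11
  have d2 : ∀ s, HasDerivAt y2 (y3 s) s := fun s =>
    ((e11 s).add (e22 s)).congr_deriv (by simp only [hy3]; ring)
  have d3 : ∀ s, HasDerivAt y3 (y4 s) s := fun s =>
    (((e11 s).add ((e22 s).const_mul 3)).add (e33 s)).congr_deriv (by simp only [hy4]; ring)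
  have hrad : ∀ x, x ≠ 0 → φ x = y (log ‖x‖) := fun x hx => by
    refine hφ.radial _ _ ?_
    rw [norm_smul, hen, mul_one, Real.norm_eq_abs, abs_of_pos (exp_pos _),
      exp_log (norm_pos_iff.2 hx)]
  have hexp2 : ∀ s : ℝ, HasDerivAt (fun s => exp (-2 * s)) (exp (-2 * s) * (-2)) s := fun s => by
    simpa using ((hasDerivAt_id s).const_mul (-2 : ℝ)).exp
  have hlap : ∀ x, x ≠ 0 → Δ φ x = (fun s => exp (-2 * s) * (y2 s + (n - 2) * y1 s)) (log ‖x‖) :=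
    fun x hx => laplacian_eq_of_log_norm d0 d1 hx hrad
  have l1 : ∀ s, HasDerivAt (fun s => exp (-2 * s) * (y2 s + (n - 2) * y1 s))
      (exp (-2 * s) * (y3 s + (n - 4) * y2 s - 2 * (n - 2) * y1 s)) s := fun s =>
    ((hexp2 s).mul ((d2 s).add ((d1 s).const_mul _))).congr_deriv
      (by simp only [Pi.add_apply]; ring)
  have l2 : ∀ s, HasDerivAt (fun s => exp (-2 * s) * (y3 s + (n - 4) * y2 s - 2 * (n - 2) * y1 s))
      (exp (-2 * s) * (y4 s + (n - 6) * y3 s - 4 * (n - 3) * y2 s + 4 * (n - 2) * y1 s)) s :=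
    fun s => ((hexp2 s).mul (((d3 s).add ((d2 s).const_mul _)).sub ((d1 s).const_mul _))).congr_deriv
      (by simp only [Pi.add_apply, Pi.sub_apply]; ring)
  have hode : ∀ s, y4 s = exp (4 * s) * y s ^ p - 2 * (n - 4) * y3 s
      - ((n : ℝ) ^ 2 - 10 * n + 20) * y2 s + 2 * (n - 2) * (n - 4) * y1 s := fun s => by
    have hne : exp s • e ≠ 0 := smul_ne_zero (exp_pos s).ne' (by
      rw [← norm_ne_zero_iff, hen]; norm_num)
    have hlog : log ‖exp s • e‖ = s := by
      rw [norm_smul, hen, mul_one, Real.norm_eq_abs, abs_of_pos (exp_pos _), log_exp]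
    have := laplacian_eq_of_log_norm l1 l2 hne hlap
    rw [hφ.equation, hlog, hrad _ hne, hlog] at this
    have he4 : exp (4 * s) * (exp (-2 * s) * exp (-2 * s)) = 1 := by
      rw [← exp_add, ← exp_add, ← exp_zero]
      congr 1
      ring
    clear_value y y1 y2 y3 y4
    have hy4' : exp (4 * s) * y s ^ p = exp (4 * s) * (exp (-2 * s) * exp (-2 * s)) *
        (y4 s + 2 * (n - 4) * y3 s + ((n : ℝ) ^ 2 - 10 * n + 20) * y2 s
          - 2 * (n - 2) * (n - 4) * y1 s) := by
      rw [this]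
      ring
    rw [hy4', he4]
    ring
  have hlimE : Tendsto exp atBot (𝓝 0) := Real.tendsto_exp_atBot
  have hlim : ∀ j k : ℕ, k ≤ 4 → 0 < j →
      Tendsto (fun s => exp s ^ j * iteratedDeriv k h (exp s)) atBot (𝓝 0) := fun j k hk hj => by
    have := (hlimE.pow j).mul (((hcont k hk).tendsto 0).comp hlimE)
    rwa [zero_pow hj.ne', zero_mul] at this
  have t1 := hlim 1 1 (by norm_num) one_pos
  have t2 := hlim 2 2 (by norm_num) two_pos
  have t3 := hlim 3 3 (by norm_num) three_pos
  have ty2 : Tendsto y2 atBot (𝓝 0) := by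
    have := t1.add t2
    rwa [add_zero] at this
  have ty3 : Tendsto y3 atBot (𝓝 0) := by
    have := (t1.add (t2.const_mul 3)).add t3
    rwa [mul_zero, add_zero, add_zero] at this
  have ty : Tendsto y atBot (𝓝 (φ 0)) := by
    have := (hC.continuous.tendsto 0).comp hlimE
    rwa [show h 0 = φ 0 by simp [hh]] at this
  exact ⟨y, y1, y2, y3, hrad, ⟨d0, d1, d2, fun s => (d3 s).congr_deriv (hode s),
    fun s => hφ.pos _⟩, ⟨ty, t1, ty2, ty3⟩⟩

/-! ### Monotonicity and decay of regular solutions -/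

theorem hasDerivAt_exp_mul (k s : ℝ) : HasDerivAt (fun s => exp (k * s)) (exp (k * s) * k) s := by
  simpa using ((hasDerivAt_id s).const_mul k).exp

/-- Integrating with the factor `e^(ks)` from `-∞`, where the boundary term vanishes; the bound is
the particular solution of `F' + k F = c e^(js)`. -/
theorem ge_of_deriv_add_mul_ge {k j c : ℝ} (hkj : 0 < k + j) {F F1 : ℝ → ℝ}
    (h1 : ∀ s, HasDerivAt F (F1 s) s) (hle : ∀ s, c * exp (j * s) ≤ F1 s + k * F s)
    (hlim : Tendsto (fun s => exp (k * s) * F s) atBot (𝓝 0)) (s : ℝ) :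
    c / (k + j) * exp (j * s) ≤ F s := by
  have hadd : ∀ s, exp ((k + j) * s) = exp (k * s) * exp (j * s) := fun s => by
    rw [← exp_add, add_mul]
  have hd : ∀ s, HasDerivAt (fun s => exp (k * s) * F s - c / (k + j) * exp ((k + j) * s))
      (exp (k * s) * (F1 s + k * F s - c * exp (j * s))) s := fun s => by
    refine (((hasDerivAt_exp_mul k s).mul (h1 s)).sub
      ((hasDerivAt_exp_mul (k + j) s).const_mul _)).congr_deriv ?_
    rw [hadd]
    field_simp
    ring
  have hmono : Monotone (fun s => exp (k * s) * F s - c / (k + j) * exp ((k + j) * s)) :=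
    monotone_of_hasDerivAt_nonneg hd fun s =>
      mul_nonneg (exp_pos _).le (by linarith [hle s])
  have hlim2 : Tendsto (fun s => exp ((k + j) * s)) atBot (𝓝 0) :=
    Real.tendsto_exp_atBot.comp (tendsto_id.const_mul_atBot hkj)
  have hge : 0 ≤ exp (k * s) * F s - c / (k + j) * exp ((k + j) * s) := by
    refine hmono.le_of_tendsto ?_ s
    simpa using hlim.sub (hlim2.const_mul (c / (k + j)))
  rw [hadd] at hge
  have : 0 ≤ exp (k * s) * (F s - c / (k + j) * exp (j * s)) := by linarith
  linarith [(mul_nonneg_iff_of_pos_left (exp_pos _)).1 this]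

/-- On an interval of length at most one the integrating factor stays between `e^(-|k|)` and
`e^|k|`; using both bounds produces the square. -/
theorem linear_growth_of_deriv_add_mul_ge {k c a b : ℝ} (hc : 0 ≤ c) (hb : b ≤ a + 1)
    {F F1 : ℝ → ℝ} (h1 : ∀ s, HasDerivAt F (F1 s) s)
    (hle : ∀ s ∈ Icc a b, c ≤ F1 s + k * F s) (ha : 0 ≤ F a) :
    ∀ s ∈ Icc a b, exp (-|k|) ^ 2 * c * (s - a) ≤ F s := by
  have hbound : ∀ s ∈ Icc a b, |k * (s - a)| ≤ |k| := fun s hs => by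
    rw [abs_mul]
    refine mul_le_of_le_one_right (abs_nonneg _) ?_
    rw [abs_of_nonneg (by linarith [hs.1])]
    linarith [hs.2]
  have hd : ∀ s, HasDerivAt (fun s => exp (k * (s - a)) * F s - exp (-|k|) * c * (s - a))
      (exp (k * (s - a)) * (F1 s + k * F s) - exp (-|k|) * c) s := fun s => by
    refine (((((hasDerivAt_id s).sub_const a).const_mul k).exp.mul (h1 s)).sub
      (((hasDerivAt_id s).sub_const a).const_mul (exp (-|k|) * c))).congr_deriv ?_
    simp only [id]
    ring
  have hmono : MonotoneOn (fun s => exp (k * (s - a)) * F s - exp (-|k|) * c * (s - a))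
      (Icc a b) := by
    refine monotoneOn_of_deriv_nonneg (convex_Icc _ _)
      (fun s _ => (hd s).continuousAt.continuousWithinAt)
      (fun s _ => (hd s).differentiableAt.differentiableWithinAt) fun s hs => ?_
    have hs' := interior_subset hs
    rw [(hd s).deriv, sub_nonneg]
    exact mul_le_mul (exp_le_exp.2 (abs_le.1 (hbound s hs')).1) (hle s hs') hc (exp_pos _).le
  intro s hs
  have h := hmono (left_mem_Icc.2 (hs.1.trans hs.2)) hs hs.1
  simp only [sub_self, mul_zero, exp_zero, one_mul, sub_zero] at h
  have hF : exp (-|k|) * c * (s - a) ≤ exp (k * (s - a)) * F s := by linarith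
  have h0 : 0 ≤ exp (-|k|) * c * (s - a) :=
    mul_nonneg (mul_nonneg (exp_pos _).le hc) (by linarith [hs.1])
  have hF0 : 0 ≤ F s := (mul_nonneg_iff_of_pos_left (exp_pos _)).1 (h0.trans hF)
  have hup : exp (k * (s - a)) ≤ exp |k| := exp_le_exp.2 (abs_le.1 (hbound s hs)).2
  have h2 : exp (-|k|) * c * (s - a) ≤ exp |k| * F s :=
    hF.trans (mul_le_mul_of_nonneg_right hup hF0)
  have h3 := mul_le_mul_of_nonneg_left h2 (exp_pos (-|k|)).le
  rw [← mul_assoc (exp (-|k|)) (exp |k|), ← exp_add, neg_add_cancel, exp_zero, one_mul] at h3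
  linarith [h3]

/-- A superlinear growth estimate over arbitrarily short steps forces blow-up. -/
theorem false_of_superlinear_steps {p κ s₀ : ℝ} (hp : 1 < p) (hκ : 0 < κ) {y : ℝ → ℝ}
    (hmono : MonotoneOn y (Ici s₀)) (hunb : ∀ A, ∃ S, s₀ ≤ S ∧ A ≤ y S)
    (hstep : ∀ S, s₀ ≤ S → ∀ h, 0 < h → h ≤ 1 / 4 → κ * h ^ 4 * y S ^ p ≤ y (S + 4 * h)) :
    False := by
  have hp1 : 0 < p - 1 := by linarith
  -- Steps halve, so `h^4` loses a factor `16` each time; `b^(p-1) = 16` compensates for it, and `A`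
  -- is chosen so that the induction `y ≥ A b^k` closes with equality. The points `S + 1 - 2^(-k)`
  -- stay below `S + 1`, so `y (S + 1)` would be infinite.
  set b : ℝ := 16 ^ (1 / (p - 1)) with hb
  have hb1 : 1 < b := one_lt_rpow (by norm_num) (by positivity)
  have hb0 : 0 < b := by linarith
  have hbp : b ^ (p - 1) = 16 := by
    rw [hb, ← rpow_mul (by norm_num), one_div_mul_cancel hp1.ne', rpow_one]
  set A : ℝ := (b * 2 ^ 12 / κ) ^ (1 / (p - 1)) with hA
  have hA0 : 0 < A := rpow_pos_of_pos (by positivity) _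
  have hAp : A ^ (p - 1) = b * 2 ^ 12 / κ := by
    rw [hA, ← rpow_mul (by positivity), one_div_mul_cancel hp1.ne', rpow_one]
  obtain ⟨S, hS, hAS⟩ := hunb A
  have hpow : ∀ x : ℝ, 0 < x → x ^ p = x * x ^ (p - 1) := fun x hx => by
    rw [← rpow_one_add' hx.le (by linarith)]
    congr 1
    ring
  have hpt : ∀ k : ℕ, s₀ ≤ S + 1 - (1 / 2) ^ k ∧ S + 1 - (1 / 2) ^ k ≤ S + 1 := fun k => by
    have h1 : ((1 : ℝ) / 2) ^ k ≤ 1 := pow_le_one₀ (by norm_num) (by norm_num)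
    have h2 : (0 : ℝ) < (1 / 2) ^ k := by positivity
    constructor <;> linarith
  have hiter : ∀ k : ℕ, A * b ^ k ≤ y (S + 1 - (1 / 2) ^ k) := fun k => by
    induction k with
    | zero => simpa using hAS
    | succ k ih =>
      have hs := hstep _ (hpt k).1 ((1 / 2) ^ (k + 3)) (by positivity) (by
        rw [pow_add]
        have h1 : ((1 : ℝ) / 2) ^ k ≤ 1 := pow_le_one₀ (by norm_num) (by norm_num)
        norm_num at h1 ⊢
        linarith)
      have he : S + 1 - (1 / 2 : ℝ) ^ k + 4 * (1 / 2) ^ (k + 3) = S + 1 - (1 / 2) ^ (k + 1) := by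
        ring
      rw [he] at hs
      refine le_trans ?_ hs
      have hle : (A * b ^ k) ^ p ≤ y (S + 1 - (1 / 2) ^ k) ^ p :=
        rpow_le_rpow (by positivity) ih (by linarith)
      refine le_trans (le_of_eq ?_) (mul_le_mul_of_nonneg_left hle (by positivity))
      have hbk : (b ^ k) ^ (p - 1) = 16 ^ k := by
        rw [← rpow_natCast, ← rpow_mul hb0.le, mul_comm, rpow_mul hb0.le, hbp, rpow_natCast]
      rw [hpow _ (by positivity), mul_rpow hA0.le (by positivity), hAp, hbk]
      have h16 : (((1 : ℝ) / 2) ^ (k + 3)) ^ 4 * 16 ^ k = 1 / 2 ^ 12 := by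
        rw [← pow_mul, show (k + 3) * 4 = 4 * k + 12 by ring, pow_add, pow_mul, mul_right_comm,
          ← mul_pow]
        norm_num
      calc A * b ^ (k + 1) = κ * (1 / 2 ^ 12) * (A * b ^ k * (b * 2 ^ 12 / κ)) := by
            rw [pow_succ]
            field_simp
        _ = _ := by
            rw [← h16]
            ring
  obtain ⟨k, hk⟩ := pow_unbounded_of_one_lt (y (S + 1) / A) hb1
  rw [div_lt_iff₀ hA0] at hk
  have := hmono (mem_Ici.2 (hpt k).1) (mem_Ici.2 (by linarith)) (hpt k).2
  linarith [hiter k]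

namespace IsLogRadialSolution

variable {n p c : ℝ} {y y1 y2 y3 : ℝ → ℝ}

/-- The equation is integrated one first-order factor at a time: `A = ∂ (∂ - 2) y`, then `B = (∂ + n
- 4) A`, and `(∂ + n - 2) B = e^(4s) y^p`. -/
theorem hasDerivAt_A (h : IsLogRadialSolution n p y y1 y2 y3) (s : ℝ) :
    HasDerivAt (fun s => y2 s - 2 * y1 s) (y3 s - 2 * y2 s) s :=
  (h.deriv2 s).sub ((h.deriv1 s).const_mul 2)

theorem hasDerivAt_B (h : IsLogRadialSolution n p y y1 y2 y3) (s : ℝ) :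
    HasDerivAt (fun s => y3 s + (n - 6) * y2 s - 2 * (n - 4) * y1 s)
      (exp (4 * s) * y s ^ p - (n - 2) * (y3 s + (n - 6) * y2 s - 2 * (n - 4) * y1 s)) s :=
  (((h.deriv3 s).add ((h.deriv2 s).const_mul _)).sub ((h.deriv1 s).const_mul _)).congr_deriv
    (by ring)

/-- A lower bound for the solution gives lower bounds for the factored derivatives. -/
theorem lower_bounds (h : IsLogRadialSolution n p y y1 y2 y3) (hn : 4 < n)
    (hreg : IsRegularAtBot c y y1 y2 y3) {K : ℝ} (hK : ∀ s, K ≤ y s ^ p) (s : ℝ) :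
    K / (n + 2) * exp (4 * s) ≤ y3 s + (n - 6) * y2 s - 2 * (n - 4) * y1 s ∧
      K / (n + 2) / n * exp (4 * s) ≤ y2 s - 2 * y1 s := by
  have hexp : ∀ k : ℝ, 0 < k → Tendsto (fun s => exp (k * s)) atBot (𝓝 0) := fun k hk =>
    Real.tendsto_exp_atBot.comp (tendsto_id.const_mul_atBot hk)
  have hA : Tendsto (fun s => y2 s - 2 * y1 s) atBot (𝓝 0) := by
    simpa using hreg.tendsto2.sub (hreg.tendsto1.const_mul 2)
  have hB : Tendsto (fun s => y3 s + (n - 6) * y2 s - 2 * (n - 4) * y1 s) atBot (𝓝 0) := by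
    simpa using (hreg.tendsto3.add (hreg.tendsto2.const_mul (n - 6))).sub
      (hreg.tendsto1.const_mul (2 * (n - 4)))
  have hBle : ∀ s, K / (n + 2) * exp (4 * s) ≤
      y3 s + (n - 6) * y2 s - 2 * (n - 4) * y1 s := fun s => by
    have := ge_of_deriv_add_mul_ge (k := n - 2) (j := 4) (c := K) (by linarith) h.hasDerivAt_B
      (fun s => by
        have := mul_le_mul_of_nonneg_right (hK s) (exp_pos (4 * s)).le
        linarith)
      (by simpa using (hexp (n - 2) (by linarith)).mul hB) s
    rwa [show n - 2 + 4 = n + 2 by ring] at this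
  refine ⟨hBle s, ?_⟩
  have := ge_of_deriv_add_mul_ge (k := n - 4) (j := 4) (c := K / (n + 2)) (by linarith)
    h.hasDerivAt_A (fun s => by linarith [hBle s])
    (by simpa using (hexp (n - 4) (by linarith)).mul hA) s
  rwa [sub_add_cancel] at this

theorem hasDerivAt_D (h : IsLogRadialSolution n p y y1 y2 y3) (s : ℝ) :
    HasDerivAt (fun s => exp (-2 * s) * y1 s) (exp (-2 * s) * (y2 s - 2 * y1 s)) s :=
  ((hasDerivAt_exp_mul (-2) s).mul (h.deriv1 s)).congr_deriv (by ring)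

/-- The radial derivative of a regular solution is never positive. -/
theorem deriv_nonpos (h : IsLogRadialSolution n p y y1 y2 y3) (hn : 4 < n) (hp : 1 < p)
    (hreg : IsRegularAtBot c y y1 y2 y3) (s : ℝ) : y1 s ≤ 0 := by
  by_contra! hpos
  have hAB := h.lower_bounds hn hreg (K := 0) fun s => (rpow_pos_of_pos (h.pos s) p).le
  simp only [zero_div, zero_mul] at hAB
  -- Since `A ≥ 0`, a positive derivative persists, and `y` then grows at least linearly.
  have hD : Monotone fun s => exp (-2 * s) * y1 s :=
    monotone_of_hasDerivAt_nonneg h.hasDerivAt_D fun s => mul_nonneg (exp_pos _).le (hAB s).2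
  set s₀ := max s 0 with hs₀
  set d := exp (-2 * s) * y1 s with hd
  have hd0 : 0 < d := mul_pos (exp_pos _) hpos
  have hy1 : ∀ x, s₀ ≤ x → d ≤ y1 x := fun x hx => by
    have h0 : 0 ≤ x := (le_max_right _ _).trans hx
    have h1 : d ≤ exp (-2 * x) * y1 x := hD ((le_max_left s 0).trans hx)
    have h2 : 0 ≤ y1 x := ((mul_pos_iff_of_pos_left (exp_pos _)).1 (hd0.trans_le h1)).le
    exact h1.trans (mul_le_of_le_one_left h2 (exp_le_one_iff.2 (by linarith)))
  have hmono : MonotoneOn y (Ici s₀) := by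
    refine monotoneOn_of_deriv_nonneg (convex_Ici _)
      (fun s _ => (h.deriv0 s).continuousAt.continuousWithinAt)
      (fun s _ => (h.deriv0 s).differentiableAt.differentiableWithinAt) fun x hx => ?_
    rw [(h.deriv0 x).deriv]
    exact hd0.le.trans (hy1 x (interior_subset hx))
  have hlin : ∀ x, s₀ ≤ x → d * (x - s₀) ≤ y x := fun x hx => by
    have hm : MonotoneOn (fun x => y x - d * x) (Ici s₀) := by
      have hdd : ∀ x, HasDerivAt (fun x => y x - d * x) (y1 x - d) x := fun x =>
        ((h.deriv0 x).sub ((hasDerivAt_id x).const_mul d)).congr_deriv (by rw [mul_one])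
      refine monotoneOn_of_deriv_nonneg (convex_Ici _)
        (fun s _ => (hdd s).continuousAt.continuousWithinAt)
        (fun s _ => (hdd s).differentiableAt.differentiableWithinAt) fun x hx => ?_
      rw [(hdd x).deriv]
      linarith [hy1 x (interior_subset hx)]
    have := hm (mem_Ici.2 le_rfl) (mem_Ici.2 hx) hx
    simp only at this
    linarith [h.pos s₀]
  -- One factor for each of the four integrations, through `B`, `A`, `y1` and `y`. Each starts a
  -- further `t` to the right and gains a factor `t`, whence `t^4` over a step of length `4t ≤ 1`.
  set κ := exp (-|n - 2|) ^ 2 * exp (-|n - 4|) ^ 2 * exp (-|(-2 : ℝ)|) ^ 2 * exp (-|(0 : ℝ)|) ^ 2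
    with hκ
  refine false_of_superlinear_steps (κ := κ) hp (by positivity) hmono (fun A => ?_) ?_
  · refine ⟨s₀ + |A| / d, by linarith [div_nonneg (abs_nonneg A) hd0.le], ?_⟩
    have := hlin (s₀ + |A| / d) (by linarith [div_nonneg (abs_nonneg A) hd0.le])
    rw [add_sub_cancel_left, mul_div_cancel₀ _ hd0.ne'] at this
    exact (le_abs_self A).trans this
  · intro S hS t ht ht4
    have hS0 : 0 ≤ S := (le_max_right _ _).trans hS
    have hM : 0 ≤ y S ^ p := (rpow_pos_of_pos (h.pos S) p).le
    have b1 := linear_growth_of_deriv_add_mul_ge (k := n - 2) (c := y S ^ p) (a := S)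
      (b := S + 4 * t) hM (by linarith) h.hasDerivAt_B (fun x hx => by
        rw [sub_add_cancel]
        have h1 : y S ^ p ≤ y x ^ p := rpow_le_rpow (h.pos S).le
          (hmono (mem_Ici.2 hS) (mem_Ici.2 (hS.trans hx.1)) hx.1) (by linarith)
        have h2 : 1 ≤ exp (4 * x) := one_le_exp (by linarith [hx.1])
        exact h1.trans (le_mul_of_one_le_left (hM.trans h1) h2)) (hAB S).1
    have b2 := linear_growth_of_deriv_add_mul_ge (k := n - 4)
      (c := exp (-|n - 2|) ^ 2 * y S ^ p * t) (a := S + t)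
      (b := S + 4 * t) (by positivity) (by linarith) h.hasDerivAt_A (fun x hx => by
        have h1 := b1 x ⟨by linarith [hx.1], hx.2⟩
        have h2 : exp (-|n - 2|) ^ 2 * y S ^ p * t ≤ exp (-|n - 2|) ^ 2 * y S ^ p * (x - S) :=
          mul_le_mul_of_nonneg_left (by linarith [hx.1]) (by positivity)
        linarith) (hAB _).2
    have b3 := linear_growth_of_deriv_add_mul_ge (k := -2)
      (c := exp (-|n - 4|) ^ 2 * (exp (-|n - 2|) ^ 2 * y S ^ p * t) * t) (a := S + 2 * t)
      (b := S + 4 * t) (by positivity) (by linarith) h.deriv1 (fun x hx => by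
        have h1 := b2 x ⟨by linarith [hx.1], hx.2⟩
        refine le_trans ?_ (h1.trans (by linarith))
        exact mul_le_mul_of_nonneg_left (by linarith [hx.1]) (by positivity))
        (hd0.le.trans (hy1 _ (by linarith)))
    have b4 := linear_growth_of_deriv_add_mul_ge (k := 0)
      (c := exp (-|(-2 : ℝ)|) ^ 2 *
        (exp (-|n - 4|) ^ 2 * (exp (-|n - 2|) ^ 2 * y S ^ p * t) * t) * t) (a := S + 3 * t)
      (b := S + 4 * t) (by positivity) (by linarith) h.deriv0 (fun x hx => by
        have h1 := b3 x ⟨by linarith [hx.1], hx.2⟩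
        refine le_trans ?_ (h1.trans (by linarith))
        exact mul_le_mul_of_nonneg_left (by linarith [hx.1]) (by positivity))
        (h.pos _).le (S + 4 * t) ⟨by linarith, le_rfl⟩
    refine le_trans (le_of_eq ?_) b4
    rw [hκ]
    ring

/-- Regular solutions decay to zero at infinity. -/
theorem tendsto_atTop (h : IsLogRadialSolution n p y y1 y2 y3) (hn : 4 < n) (hp : 1 < p)
    (hreg : IsRegularAtBot c y y1 y2 y3) : Tendsto y atTop (𝓝 0) := by
  have hanti : Antitone y :=
    antitone_of_hasDerivAt_nonpos h.deriv0 fun s => h.deriv_nonpos hn hp hreg s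
  have hbdd : BddBelow (range y) := ⟨0, by rintro _ ⟨s, rfl⟩; exact (h.pos s).le⟩
  have hlim := tendsto_atTop_ciInf hanti hbdd
  set l := ⨅ s, y s
  have hl0 : 0 ≤ l := le_ciInf fun s => (h.pos s).le
  rcases hl0.eq_or_lt with hl | hl
  · rwa [← hl] at hlim
  exfalso
  -- A positive limit forces `A ≥ K e^(4s)`, so `e^(-2s) y1` grows at least like `(K/2) e^(2s)` and
  -- `y1` becomes positive; `T` is a point where this already contradicts `y1 ≤ 0`.
  set K := l ^ p / (n + 2) / n with hK
  have hK0 : 0 < K := by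
    have := rpow_pos_of_pos hl p
    positivity
  have hA : ∀ s, K * exp (4 * s) ≤ y2 s - 2 * y1 s := fun s =>
    (h.lower_bounds hn hreg
      (fun s => rpow_le_rpow hl.le (ciInf_le hbdd s) (by linarith)) s).2
  have hd : ∀ s, HasDerivAt (fun s => exp (-2 * s) * y1 s - K / 2 * exp (2 * s))
      (exp (-2 * s) * (y2 s - 2 * y1 s - K * exp (4 * s))) s := fun s => by
    refine ((h.hasDerivAt_D s).sub ((hasDerivAt_exp_mul 2 s).const_mul _)).congr_deriv ?_
    have : exp (2 * s) = exp (-2 * s) * exp (4 * s) := by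
      rw [← exp_add]
      congr 1
      ring
    rw [this]
    ring
  have hmono : Monotone fun s => exp (-2 * s) * y1 s - K / 2 * exp (2 * s) :=
    monotone_of_hasDerivAt_nonneg hd fun s => mul_nonneg (exp_pos _).le (by linarith [hA s])
  set T := |y1 0| / K + 1
  have hT0 : 0 ≤ T := by positivity
  have h1 := hmono hT0
  simp only [mul_zero, exp_zero, one_mul, mul_one] at h1
  have h2 : exp (-2 * T) * y1 T ≤ 0 :=
    mul_nonpos_of_nonneg_of_nonpos (exp_pos _).le (h.deriv_nonpos hn hp hreg T)
  have h3 : K / 2 * (2 * T + 1) ≤ K / 2 * exp (2 * T) :=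
    mul_le_mul_of_nonneg_left (add_one_le_exp _) (by positivity)
  have h4 : K * T = |y1 0| + K := by
    simp only [T]
    field_simp
  linarith [neg_abs_le (y1 0)]

end IsLogRadialSolution

/-! ### The stability condition and the critical exponent -/

/-- `p Q₄(4 / (p - 1))` as a polynomial in `m = 4 / (p - 1)`. -/
def stabilityQuartic (n m : ℝ) : ℝ := (m + 2) * (m + 4) * (n - 2 - m) * (n - 4 - m)

theorem mul_quarticQ_eq (n : ℕ) {p : ℝ} (hp : 1 < p) :
    p * quarticQ n (4 / (p - 1)) = stabilityQuartic n (4 / (p - 1)) := by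
  have hp1 : p - 1 ≠ 0 := by linarith
  have : p * (4 / (p - 1)) = 4 / (p - 1) + 4 := by field_simp; ring
  rw [quarticQ, stabilityQuartic, mul_assoc, mul_assoc, ← mul_assoc p, this]
  ring

theorem quarticQ_half (n : ℕ) : quarticQ n (((n : ℝ) - 4) / 2) = (n : ℝ) ^ 2 * (n - 4) ^ 2 / 16 := by
  rw [quarticQ]; ring

theorem one_lt_of_sobolevExponent_lt {n : ℕ} {p : ℝ} (hn : 4 < n) (hp : sobolevExponent n < p) :
    1 < p := by
  have hn' : (4 : ℝ) < n := by exact_mod_cast hn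
  refine lt_trans ?_ hp
  rw [sobolevExponent, lt_div_iff₀ (by linarith)]
  linarith

theorem sobolevExponent_lt_iff {n : ℕ} {p : ℝ} (hn : 4 < n) (hp : 1 < p) :
    sobolevExponent n < p ↔ 4 / (p - 1) < ((n : ℝ) - 4) / 2 := by
  have hn' : (4 : ℝ) < n := by exact_mod_cast hn
  rw [sobolevExponent, div_lt_iff₀ (by linarith), div_lt_iff₀ (by linarith)]
  constructor <;> intro h <;> nlinarith

/-- The quartic is strictly increasing below any point where the stability condition holds. -/
theorem stabilityQuartic_lt {n a b : ℝ} (hn : 4 < n) (ha : 0 ≤ a) (hab : a < b)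
    (hb : b < (n - 4) / 2) (hs : stabilityQuartic n b ≤ n ^ 2 * (n - 4) ^ 2 / 16) :
    stabilityQuartic n a < stabilityQuartic n b := by
  -- The quartic is symmetric about `m = (n - 6) / 2`, hence a quadratic in the squared distance to
  -- that centre.
  have hform : ∀ m, stabilityQuartic n m = ((m - (n - 6) / 2) ^ 2 - ((n - 2) / 2) ^ 2) *
      ((m - (n - 6) / 2) ^ 2 - ((n + 2) / 2) ^ 2) := fun m => by rw [stabilityQuartic]; ring
  rw [hform] at hs ⊢
  rw [hform]
  -- Within distance `1` of the centre the quartic is at least `n² (n² - 16) / 16`, above the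
  -- Rellich constant. So `b` lies to the left, where the quadratic is decreasing in the squared
  -- distance.
  have hb1 : b - (n - 6) / 2 < -1 := by
    by_contra! h
    have hT : (b - (n - 6) / 2) ^ 2 ≤ 1 := by nlinarith
    set T := (b - (n - 6) / 2) ^ 2
    have hT0 : 0 ≤ T := sq_nonneg _
    have e1 : n * (n - 4) / 4 ≤ ((n - 2) / 2) ^ 2 - T := by nlinarith
    have e2 : n * (n + 4) / 4 ≤ ((n + 2) / 2) ^ 2 - T := by nlinarith
    have h0 : 0 < n * (n - 4) / 4 := by
      have : 0 < n - 4 := by linarith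
      positivity
    have h1 : n * (n - 4) / 4 * (n * (n + 4) / 4) ≤
        (((n - 2) / 2) ^ 2 - T) * (((n + 2) / 2) ^ 2 - T) :=
      mul_le_mul e1 e2 (by positivity) (by linarith)
    nlinarith
  have hA : (a - (n - 6) / 2) ^ 2 ≤ ((n - 6) / 2) ^ 2 := by nlinarith
  have hB : (b - (n - 6) / 2) ^ 2 < (a - (n - 6) / 2) ^ 2 := by nlinarith
  have hB0 : 0 ≤ (b - (n - 6) / 2) ^ 2 := sq_nonneg _
  nlinarith

theorem four_div_sub_one_lt {p q : ℝ} (hp : 1 < p) (hpq : p < q) : 4 / (q - 1) < 4 / (p - 1) :=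
  div_lt_div_of_pos_left (by norm_num) (by linarith) (by linarith)

theorem stabilityCondition_iff {n : ℕ} {p : ℝ} (hp : 1 < p) :
    StabilityCondition n p ↔
      stabilityQuartic n (4 / (p - 1)) ≤ (n : ℝ) ^ 2 * (n - 4) ^ 2 / 16 := by
  rw [StabilityCondition, mul_quarticQ_eq n hp, quarticQ_half]

/-- By strict monotonicity the value at `m = 0`, namely `8 (n - 2) (n - 4)`, lies below the Rellich
constant; this fails for `5 ≤ n ≤ 12`. -/
theorem thirteen_le_of_stabilityCondition {n : ℕ} {p : ℝ} (hn : 4 < n)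
    (hp : sobolevExponent n < p) (hs : StabilityCondition n p) : 13 ≤ n := by
  have hn' : (4 : ℝ) < n := by exact_mod_cast hn
  have hp1 := one_lt_of_sobolevExponent_lt hn hp
  rw [stabilityCondition_iff hp1] at hs
  have h := (stabilityQuartic_lt hn' le_rfl (div_pos (by norm_num) (by linarith))
    ((sobolevExponent_lt_iff hn hp1).1 hp) hs).trans_le hs
  by_contra! hlt
  rw [stabilityQuartic] at h
  interval_cases n <;> norm_num at h

theorem isCriticalExponent_iff {n : ℕ} {p : ℝ} (hn : 4 < n) :
    IsCriticalExponent n p ↔ sobolevExponent n < p ∧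
      stabilityQuartic n (4 / (p - 1)) = (n : ℝ) ^ 2 * (n - 4) ^ 2 / 16 := by
  rw [IsCriticalExponent]
  refine and_congr_right fun hp => ?_
  rw [mul_quarticQ_eq n (one_lt_of_sobolevExponent_lt hn hp), quarticQ_half]

/-- A critical exponent is at most any exponent satisfying the stability condition. -/
theorem IsCriticalExponent.le_of_stabilityCondition {n : ℕ} {pc p : ℝ} (hn : 4 < n)
    (hpc : IsCriticalExponent n pc) (hp : sobolevExponent n < p) (hs : StabilityCondition n p) :
    pc ≤ p := by
  have hn' : (4 : ℝ) < n := by exact_mod_cast hn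
  have hp1 := one_lt_of_sobolevExponent_lt hn hp
  rw [isCriticalExponent_iff hn] at hpc
  rw [stabilityCondition_iff hp1] at hs
  by_contra! hlt
  have := stabilityQuartic_lt hn' (a := 4 / (pc - 1))
    (div_pos (by norm_num) (by linarith)).le (four_div_sub_one_lt hp1 hlt)
    ((sobolevExponent_lt_iff hn hp1).1 hp) hs
  linarith [hpc.2]

theorem IsCriticalExponent.stabilityCondition {n : ℕ} {pc p : ℝ} (hn : 4 < n)
    (hpc : IsCriticalExponent n pc) (hle : pc ≤ p) : StabilityCondition n p := by
  have hn' : (4 : ℝ) < n := by exact_mod_cast hn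
  have hpc1 := one_lt_of_sobolevExponent_lt hn hpc.1
  rcases hle.eq_or_lt with rfl | hlt
  · exact hpc.2.le
  have hc := (isCriticalExponent_iff hn).1 hpc
  rw [stabilityCondition_iff (hpc1.trans hlt)]
  exact ((stabilityQuartic_lt hn' (div_pos (by norm_num) (by linarith)).le
    (four_div_sub_one_lt hpc1 hlt) ((sobolevExponent_lt_iff hn hpc1).1 hpc.1) hc.2.le).trans_le
    hc.2.le).le

/-- Intermediate values in `m` on `[0, (n - 4) / 2]`: the Rellich constant exceeds the left value
exactly when `128 (n - 2) < n² (n - 4)`, and the right value is `n² (n² - 16) / 16`. Then `p = 1 + 4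
/ m`. -/
theorem exists_isCriticalExponent {n : ℕ} (hn : 13 ≤ n) : ∃ pc, IsCriticalExponent n pc := by
  have hn' : (13 : ℝ) ≤ n := by exact_mod_cast hn
  have hcont : ContinuousOn (stabilityQuartic n) (Icc 0 (((n : ℝ) - 4) / 2)) := by
    unfold stabilityQuartic
    fun_prop
  have hmem : (n : ℝ) ^ 2 * (n - 4) ^ 2 / 16 ∈
      Ioo (stabilityQuartic n 0) (stabilityQuartic n (((n : ℝ) - 4) / 2)) := by
    simp only [stabilityQuartic]
    have h4 : (0 : ℝ) < n - 4 := by linarith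
    constructor
    · have : 128 * ((n : ℝ) - 2) < n ^ 2 * (n - 4) := by nlinarith
      nlinarith
    · have : (0 : ℝ) < n ^ 2 * (n - 4) := by positivity
      nlinarith
  obtain ⟨m, ⟨hm0, hm1⟩, hm⟩ := intermediate_value_Ioo (by linarith) hcont hmem
  have hp1 : (1 : ℝ) < 1 + 4 / m := by linarith [div_pos (by norm_num : (0 : ℝ) < 4) hm0]
  have hmm : 4 / (1 + 4 / m - 1) = m := by
    rw [add_sub_cancel_left]
    field_simp
  refine ⟨1 + 4 / m, (isCriticalExponent_iff (by omega)).2 ⟨?_, ?_⟩⟩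
  · rw [sobolevExponent_lt_iff (by omega) hp1, hmm]
    exact hm1
  · rw [hmm, hm]

/-! ### Separation of solutions -/

/-- A continuous function that is somewhere below both its values near `-∞` and its limit at `+∞`
attains its minimum. -/
theorem exists_min_of_tendsto_zero {u : ℝ → ℝ} {s₀ : ℝ} (hu : Continuous u) (h0 : u s₀ ≤ 0)
    (hbot : ∀ᶠ s in atBot, u s₀ < u s) (htop : Tendsto u atTop (𝓝 0)) :
    ∃ s₁, u s₁ ≤ u s₀ ∧ ∀ s, u s₁ ≤ u s := by
  rcases h0.lt_or_eq with hneg | hzero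
  · obtain ⟨s₁, hs₁⟩ := hu.exists_forall_le' (x₀ := s₀) (by
      rw [cocompact_eq_atBot_atTop, eventually_sup]
      exact ⟨hbot.mono fun _ h => h.le, (htop.eventually (lt_mem_nhds hneg)).mono
        fun _ h => h.le⟩)
    exact ⟨s₁, hs₁ s₀, hs₁⟩
  -- The value `0` is not strictly below the limit at `+∞`, so either `s₀` is already a minimum or
  -- some strictly negative value replaces it.
  · by_cases hall : ∀ s, 0 ≤ u s
    · exact ⟨s₀, le_rfl, fun s => hzero ▸ hall s⟩
    · push Not at hall
      obtain ⟨a, ha⟩ := hall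
      obtain ⟨s₁, hs₁⟩ := hu.exists_forall_le' (x₀ := a) (by
        rw [cocompact_eq_atBot_atTop, eventually_sup]
        exact ⟨hbot.mono fun _ h => by linarith, (htop.eventually (lt_mem_nhds ha)).mono
          fun _ h => h.le⟩)
      exact ⟨s₁, hs₁ s₀, hs₁⟩

/-- Convexity of the power: `b ^ p - a ^ p ≤ p b ^ (p - 1) (b - a)`. -/
theorem rpow_sub_rpow_le {p a b : ℝ} (hp : 1 < p) (ha : 0 < a) (hab : a ≤ b) :
    b ^ p - a ^ p ≤ p * b ^ (p - 1) * (b - a) := by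
  rcases hab.eq_or_lt with rfl | hlt
  · simp
  obtain ⟨c, hc, hcs⟩ := exists_hasDerivAt_eq_slope (fun x : ℝ => x ^ p)
    (fun x => p * x ^ (p - 1)) hlt
    (fun x hx =>
      (Real.hasDerivAt_rpow_const (Or.inl (by linarith [hx.1]))).continuousAt.continuousWithinAt)
    (fun x hx => Real.hasDerivAt_rpow_const (Or.inl (by linarith [hx.1])))
  rw [eq_div_iff (by linarith)] at hcs
  rw [← hcs]
  refine mul_le_mul_of_nonneg_right (mul_le_mul_of_nonneg_left ?_ (by linarith)) (by linarith)
  exact rpow_le_rpow (by linarith [hc.1]) hc.2.le (by linarith)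

/-- Separation of two solutions: if `y` is bounded by the singular solution in the sense that
`p e^(4s) y^(p-1) ≤ C` with `C` at most the Rellich constant, then `w` cannot reach `y` from
below. -/
theorem IsLogRadialSolution.lt_of_eventually_lt {n p C : ℝ} (hn : 4 < n) (hp : 1 < p)
    (hC0 : 0 ≤ C) (hC : C ≤ n ^ 2 * (n - 4) ^ 2 / 16)
    {w w1 w2 w3 y y1 y2 y3 : ℝ → ℝ} (hw : IsLogRadialSolution n p w w1 w2 w3)
    (hy : IsLogRadialSolution n p y y1 y2 y3)
    (hyC : ∀ s, p * exp (4 * s) * y s ^ (p - 1) ≤ C)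
    (l0 : Tendsto (fun s => exp ((n - 4) / 2 * s) * (y s - w s)) atBot (𝓝 0))
    (l1 : Tendsto (fun s => exp ((n - 4) / 2 * s) * (y1 s - w1 s)) atBot (𝓝 0))
    (l2 : Tendsto (fun s => exp ((n - 4) / 2 * s) * (y2 s - w2 s)) atBot (𝓝 0))
    (htop : Tendsto (fun s => y s - w s) atTop (𝓝 0)) {s₀ : ℝ}
    (hbot : ∀ᶠ s in atBot, y s₀ - w s₀ < y s - w s) : w s₀ < y s₀ := by
  by_contra! hle
  have hd0 : ∀ s, HasDerivAt (fun s => y s - w s) (y1 s - w1 s) s := fun s =>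
    (hy.deriv0 s).sub (hw.deriv0 s)
  have hcont : Continuous fun s => y s - w s :=
    continuous_iff_continuousAt.2 fun s => (hd0 s).continuousAt
  obtain ⟨s₁, hs₁, hmin⟩ := exists_min_of_tendsto_zero (u := fun s => y s - w s) hcont
    (sub_nonpos.2 hle) hbot htop
  set t := -(y s₁ - w s₁) with ht
  have ht0 : 0 ≤ t := by linarith
  have hexp : Tendsto (fun s => exp ((n - 4) / 2 * s)) atBot (𝓝 0) :=
    Real.tendsto_exp_atBot.comp (tendsto_id.const_mul_atBot (by linarith))
  have hzero := eq_zero_of_biharmonic_le (z := fun s => y s - w s + t) (s₁ := s₁) hn hC0 hC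
    (fun s => (hd0 s).add_const t)
    (fun s => (hy.deriv1 s).sub (hw.deriv1 s)) (fun s => (hy.deriv2 s).sub (hw.deriv2 s))
    (fun s => (hy.deriv3 s).sub (hw.deriv3 s)) (fun s => ?_)
    (fun s => by linarith [hmin s]) (by rw [ht]; ring) ?_ l1 l2
  · obtain ⟨s, hs, hss⟩ := (hbot.and (eventually_le_atBot s₁)).exists
    have := hzero s hss
    linarith
  · have hE : 0 < exp (4 * s) := exp_pos _
    -- Where `w ≤ y` this is convexity together with `hyC`; where `y ≤ w` the left side is
    -- nonpositive and the right side nonnegative.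
    have key : exp (4 * s) * (y s ^ p - w s ^ p) ≤ C * (y s - w s + t) := by
      rcases le_total (w s) (y s) with h | h
      · have h1 := mul_le_mul_of_nonneg_left (rpow_sub_rpow_le hp (hw.pos s) h) hE.le
        have h2 := mul_le_mul_of_nonneg_right (hyC s) (sub_nonneg.2 h)
        have h3 : 0 ≤ C * t := mul_nonneg hC0 ht0
        linarith
      · have h1 : y s ^ p ≤ w s ^ p := rpow_le_rpow (hy.pos s).le h (by linarith)
        exact (mul_nonpos_of_nonneg_of_nonpos hE.le (by linarith)).trans
          (mul_nonneg hC0 (by linarith [hmin s]))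
    linarith
  · have := l0.add (hexp.mul_const t)
    rw [zero_mul, add_zero] at this
    exact this.congr fun s => by ring

/-- The singular solution in the logarithmic radial variable. -/
theorem isLogRadialSolution_singular {n : ℕ} {p : ℝ} (hn : 4 < n) (hp : sobolevExponent n < p) :
    0 < quarticQ n (4 / (p - 1)) ∧
    IsLogRadialSolution n p
      (fun s => quarticQ n (4 / (p - 1)) ^ (1 / (p - 1)) * exp (-(4 / (p - 1)) * s))
      (fun s => quarticQ n (4 / (p - 1)) ^ (1 / (p - 1)) *
        (exp (-(4 / (p - 1)) * s) * -(4 / (p - 1))))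
      (fun s => quarticQ n (4 / (p - 1)) ^ (1 / (p - 1)) *
        (exp (-(4 / (p - 1)) * s) * (-(4 / (p - 1))) ^ 2))
      (fun s => quarticQ n (4 / (p - 1)) ^ (1 / (p - 1)) *
        (exp (-(4 / (p - 1)) * s) * (-(4 / (p - 1))) ^ 3)) ∧
    ∀ s, p * exp (4 * s) * (quarticQ n (4 / (p - 1)) ^ (1 / (p - 1)) *
      exp (-(4 / (p - 1)) * s)) ^ (p - 1) = p * quarticQ n (4 / (p - 1)) := by
  have hn' : (4 : ℝ) < n := by exact_mod_cast hn
  have hp1 := one_lt_of_sobolevExponent_lt hn hp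
  have hp0 : p - 1 ≠ 0 := by linarith
  have hm1 := (sobolevExponent_lt_iff hn hp1).1 hp
  have hm0 : 0 < 4 / (p - 1) := div_pos (by norm_num) (by linarith)
  have hmp : 4 / (p - 1) * (p - 1) = 4 := div_mul_cancel₀ _ hp0
  set m := 4 / (p - 1) with hm
  have hQ : 0 < quarticQ n m := by
    rw [quarticQ, mul_assoc]
    exact mul_pos (by positivity) (mul_pos_of_neg_of_neg (by linarith) (by linarith))
  set q := quarticQ n m with hq
  have hL : 0 < q ^ (1 / (p - 1)) := rpow_pos_of_pos hQ _
  have hLp : (q ^ (1 / (p - 1))) ^ (p - 1) = q := by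
    rw [← rpow_mul hQ.le, one_div_mul_cancel hp0, rpow_one]
  set L := q ^ (1 / (p - 1))
  have hpow : ∀ s, exp (4 * s) * (L * exp (-m * s)) ^ (p - 1) = q := fun s => by
    rw [mul_rpow hL.le (exp_pos _).le, hLp, ← exp_mul, mul_left_comm, ← exp_add]
    rw [show 4 * s + -m * s * (p - 1) = (4 - m * (p - 1)) * s by ring, hmp]
    simp
  have hexp : ∀ k s : ℝ, HasDerivAt (fun s => L * (exp (-m * s) * k))
      (L * (exp (-m * s) * (-m * k))) s := fun k s => by
    refine (((hasDerivAt_exp_mul (-m) s).mul_const k).const_mul L).congr_deriv ?_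
    ring
  refine ⟨hQ, ⟨fun s => ?_, fun s => ?_, fun s => ?_, fun s => ?_,
    fun s => mul_pos hL (exp_pos _)⟩, fun s => ?_⟩
  · exact (hasDerivAt_exp_mul (-m) s).const_mul L
  · exact (hexp (-m) s).congr_deriv (by ring)
  · exact (hexp ((-m) ^ 2) s).congr_deriv (by ring)
  · refine (hexp ((-m) ^ 3) s).congr_deriv ?_
    have hpos : 0 < L * exp (-m * s) := mul_pos hL (exp_pos _)
    have : exp (4 * s) * (L * exp (-m * s)) ^ p = q * (L * exp (-m * s)) := by
      rw [← hpow s, mul_assoc, ← rpow_add_one hpos.ne', sub_add_cancel]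
    rw [this, hq, quarticQ]
    ring
  · rw [mul_assoc, hpow]

theorem singularSolution_eq {n : ℕ} (p : ℝ) {x : EuclideanSpace ℝ (Fin n)} (hx : x ≠ 0) :
    singularSolution n p x =
      quarticQ n (4 / (p - 1)) ^ (1 / (p - 1)) * exp (-(4 / (p - 1)) * log ‖x‖) := by
  rw [singularSolution, rpow_def_of_pos (norm_pos_iff.2 hx), mul_comm (log ‖x‖)]

/-- Regular solutions lie below the singular one in the logarithmic variable. -/
theorem IsLogRadialSolution.lt_singular {n : ℕ} {p c : ℝ} (hn : 4 < n)
    (hp : sobolevExponent n < p) (hs : StabilityCondition n p) {w w1 w2 w3 : ℝ → ℝ}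
    (hw : IsLogRadialSolution n p w w1 w2 w3) (hreg : IsRegularAtBot c w w1 w2 w3) (s : ℝ) :
    w s < quarticQ n (4 / (p - 1)) ^ (1 / (p - 1)) * exp (-(4 / (p - 1)) * s) := by
  have hn' : (4 : ℝ) < n := by exact_mod_cast hn
  have hp1 := one_lt_of_sobolevExponent_lt hn hp
  obtain ⟨hQ, hsol, hC⟩ := isLogRadialSolution_singular hn hp
  rw [StabilityCondition, quarticQ_half] at hs
  have hm1 := (sobolevExponent_lt_iff hn hp1).1 hp
  have hm0 : 0 < 4 / (p - 1) := div_pos (by norm_num) (by linarith)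
  have hL := rpow_pos_of_pos hQ (1 / (p - 1))
  set m := 4 / (p - 1) with hm
  set q := quarticQ n m
  set L := q ^ (1 / (p - 1))
  have hexp : Tendsto (fun s => exp (((n : ℝ) - 4) / 2 * s)) atBot (𝓝 0) :=
    Real.tendsto_exp_atBot.comp (tendsto_id.const_mul_atBot (by linarith))
  -- Supercriticality means `m < (n - 4) / 2`, so the weight kills the singularity of `Φ` at the
  -- origin.
  have hexp2 : Tendsto (fun s => exp ((((n : ℝ) - 4) / 2 - m) * s)) atBot (𝓝 0) :=
    Real.tendsto_exp_atBot.comp (tendsto_id.const_mul_atBot (by linarith))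
  have hlim : ∀ (k d : ℝ) (v : ℝ → ℝ), Tendsto v atBot (𝓝 d) →
      Tendsto (fun s => exp (((n : ℝ) - 4) / 2 * s) * (L * (exp (-m * s) * k) - v s)) atBot
        (𝓝 0) := fun k d v hv => by
    have := (hexp2.const_mul (L * k)).sub (hexp.mul hv)
    rw [mul_zero, zero_mul, sub_zero] at this
    refine this.congr fun s => ?_
    rw [sub_mul, sub_eq_add_neg _ (m * s), exp_add, ← neg_mul]
    ring
  have htop : Tendsto (fun s => L * exp (-m * s)) atTop (𝓝 0) := by
    have := (Real.tendsto_exp_atBot.comp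
      (tendsto_id.const_mul_atTop_of_neg (neg_lt_zero.2 hm0))).const_mul L
    rw [mul_zero] at this
    exact this
  have hbot : Tendsto (fun s => L * exp (-m * s)) atBot atTop :=
    (Real.tendsto_exp_atTop.comp
      (tendsto_id.const_mul_atBot_of_neg (neg_lt_zero.2 hm0))).const_mul_atTop hL
  refine hw.lt_of_eventually_lt hn' hp1 (by positivity) hs hsol (fun s => (hC s).le) ?_
    (hlim _ _ _ hreg.tendsto1) (hlim _ _ _ hreg.tendsto2) ?_ ?_
  · simpa using hlim 1 _ _ hreg.tendsto0
  · simpa using htop.sub (hw.tendsto_atTop hn' hp1 hreg)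
  · have hge : ∀ᶠ s in atBot, -c - 1 ≤ -w s :=
      hreg.tendsto0.neg.eventually (le_mem_nhds (show -c - 1 < -c by linarith))
    exact (tendsto_atTop_add_right_of_le' _ _ hbot hge).eventually_gt_atTop _

/-- Regular solutions cannot cross: strict order at the origin side propagates. -/
theorem IsLogRadialSolution.lt_of_regular {n : ℕ} {p c d : ℝ} (hn : 4 < n)
    (hp : sobolevExponent n < p) (hs : StabilityCondition n p) {w w1 w2 w3 y y1 y2 y3 : ℝ → ℝ}
    (hw : IsLogRadialSolution n p w w1 w2 w3) (hwreg : IsRegularAtBot c w w1 w2 w3)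
    (hy : IsLogRadialSolution n p y y1 y2 y3) (hyreg : IsRegularAtBot d y y1 y2 y3) {s₀ : ℝ}
    (hs₀ : y s₀ - w s₀ < d - c) : w s₀ < y s₀ := by
  have hn' : (4 : ℝ) < n := by exact_mod_cast hn
  have hp1 := one_lt_of_sobolevExponent_lt hn hp
  obtain ⟨hQ, -, hC⟩ := isLogRadialSolution_singular hn hp
  have hexp : Tendsto (fun s => exp (((n : ℝ) - 4) / 2 * s)) atBot (𝓝 0) :=
    Real.tendsto_exp_atBot.comp (tendsto_id.const_mul_atBot (by linarith))
  have hle : p * quarticQ n (4 / (p - 1)) ≤ (n : ℝ) ^ 2 * (n - 4) ^ 2 / 16 := by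
    rw [← quarticQ_half]
    exact hs
  refine hw.lt_of_eventually_lt hn' hp1 (by positivity) hle hy (fun s => ?_)
    (by simpa using hexp.mul (hyreg.tendsto0.sub hwreg.tendsto0))
    (by simpa using hexp.mul (hyreg.tendsto1.sub hwreg.tendsto1))
    (by simpa using hexp.mul (hyreg.tendsto2.sub hwreg.tendsto2))
    (by simpa using (hy.tendsto_atTop hn' hp1 hyreg).sub (hw.tendsto_atTop hn' hp1 hwreg))
    ((hyreg.tendsto0.sub hwreg.tendsto0).eventually (lt_mem_nhds hs₀))
  rw [← hC s]
  exact mul_le_mul_of_nonneg_left (rpow_le_rpow (hy.pos s).le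
    (hy.lt_singular hn hp hs hyreg s).le (by linarith))
    (mul_nonneg (by linarith) (exp_pos _).le)

/-! ### Back to `ℝⁿ` -/

theorem IsRegularRadialSolution.lt_singularSolution {n : ℕ} {p : ℝ} (hn : 4 < n)
    (hp : sobolevExponent n < p) (hs : StabilityCondition n p)
    {φ : EuclideanSpace ℝ (Fin n) → ℝ} (hφ : IsRegularRadialSolution n p φ)
    {x : EuclideanSpace ℝ (Fin n)} (hx : x ≠ 0) : φ x < singularSolution n p x := by
  obtain ⟨w, w1, w2, w3, hφw, hw, hreg⟩ := hφ.exists_logRadial (by omega)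
  rw [hφw x hx, singularSolution_eq p hx]
  exact hw.lt_singular hn hp hs hreg _

theorem IsRegularRadialSolution.lt_of_lt_zero {n : ℕ} {p : ℝ} (hn : 4 < n)
    (hp : sobolevExponent n < p) (hs : StabilityCondition n p)
    {φ ψ : EuclideanSpace ℝ (Fin n) → ℝ} (hφ : IsRegularRadialSolution n p φ)
    (hψ : IsRegularRadialSolution n p ψ) (h0 : φ 0 < ψ 0) (x : EuclideanSpace ℝ (Fin n)) :
    φ x < ψ x := by
  rcases eq_or_ne x 0 with rfl | hx
  · exact h0
  obtain ⟨w, w1, w2, w3, hφw, hw, hwreg⟩ := hφ.exists_logRadial (by omega)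
  obtain ⟨y, y1, y2, y3, hψy, hy, hyreg⟩ := hψ.exists_logRadial (by omega)
  rw [hφw x hx, hψy x hx]
  by_contra! hle
  exact hle.not_gt (hw.lt_of_regular hn hp hs hwreg hy hyreg (by linarith))

/-- A point with `ψ < φ` would put `ψ - φ` strictly below its limit `0` at the origin, and
separation then forces `φ < ψ` there. Used both ways, this gives uniqueness for a given value at the
origin, with no uniqueness theorem for the singular ODE. -/
theorem IsRegularRadialSolution.le_of_eq_zero {n : ℕ} {p : ℝ} (hn : 4 < n)
    (hp : sobolevExponent n < p) (hs : StabilityCondition n p)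
    {φ ψ : EuclideanSpace ℝ (Fin n) → ℝ} (hφ : IsRegularRadialSolution n p φ)
    (hψ : IsRegularRadialSolution n p ψ) (h0 : φ 0 = ψ 0) (x : EuclideanSpace ℝ (Fin n)) :
    φ x ≤ ψ x := by
  rcases eq_or_ne x 0 with rfl | hx
  · exact h0.le
  obtain ⟨w, w1, w2, w3, hφw, hw, hwreg⟩ := hφ.exists_logRadial (by omega)
  obtain ⟨y, y1, y2, y3, hψy, hy, hyreg⟩ := hψ.exists_logRadial (by omega)
  rw [hφw x hx, hψy x hx]
  by_contra! hlt
  exact hlt.not_gt (hw.lt_of_regular hn hp hs hwreg hy hyreg (by linarith))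

end

theorem theorem4p3 (n : ℕ) (p : ℝ) :
    -- for `n ≥ 13` the critical exponent is well defined
    (13 ≤ n → ∃! pc : ℝ, IsCriticalExponent n pc) ∧
    -- the two forms of the assumption agree
    ((13 ≤ n ∧ ∃ pc : ℝ, IsCriticalExponent n pc ∧ pc ≤ p) ↔
      (4 < n ∧ sobolevExponent n < p ∧ StabilityCondition n p)) ∧
    -- under this assumption, regular radial solutions lie below the singular one, distinct ones
    -- never meet, and they are strictly ordered by their values at the origin
    (4 < n → sobolevExponent n < p → StabilityCondition n p →
      (∀ φ : EuclideanSpace ℝ (Fin n) → ℝ, IsRegularRadialSolution n p φ →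
        ∀ x, x ≠ 0 → φ x < singularSolution n p x) ∧
      (∀ φ ψ : EuclideanSpace ℝ (Fin n) → ℝ,
        IsRegularRadialSolution n p φ → IsRegularRadialSolution n p ψ →
          (φ ≠ ψ → ∀ x, φ x ≠ ψ x) ∧
          (φ 0 < ψ 0 → ∀ x, φ x < ψ x))) := by
  refine ⟨fun hn => ?_, ⟨?_, ?_⟩, fun hn hp hs => ⟨fun φ hφ x hx =>
    hφ.lt_singularSolution hn hp hs hx, fun φ ψ hφ hψ => ⟨fun hne x => ?_,
    fun h0 => hφ.lt_of_lt_zero hn hp hs hψ h0⟩⟩⟩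
  · have hn4 : 4 < n := by omega
    obtain ⟨pc, hpc⟩ := exists_isCriticalExponent hn
    exact ⟨pc, hpc, fun q hq => le_antisymm
      (hq.le_of_stabilityCondition hn4 hpc.1 hpc.2.le)
      (hpc.le_of_stabilityCondition hn4 hq.1 hq.2.le)⟩
  · rintro ⟨hn, pc, hpc, hle⟩
    have hn4 : 4 < n := by omega
    exact ⟨hn4, hpc.1.trans_le hle, hpc.stabilityCondition hn4 hle⟩
  · rintro ⟨hn, hp, hs⟩
    have hn13 := thirteen_le_of_stabilityCondition hn hp hs
    obtain ⟨pc, hpc⟩ := exists_isCriticalExponent hn13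
    exact ⟨hn13, pc, hpc, hpc.le_of_stabilityCondition hn hp hs⟩
  · rcases lt_trichotomy (φ 0) (ψ 0) with h | h | h
    · exact (hφ.lt_of_lt_zero hn hp hs hψ h x).ne
    · exact absurd (funext fun z => le_antisymm (hφ.le_of_eq_zero hn hp hs hψ h z)
        (hψ.le_of_eq_zero hn hp hs hφ h.symm z)) hne
    · exact (hψ.lt_of_lt_zero hn hp hs hφ h x).ne'
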